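/- Let $m,n\ge 1$ be integers and let $\underline{d}=(d_1,\dots,d_m)$ be a list of nonnegative integers with $d:=\max_i d_i>0$. Let $M(\lambda)$ be an $m\times(m+n)$ matrix of complex polynomials whose $i$th row has degree at most $d_i$ for $i=1,\dots,m$; here the degree of a polynomial vector is the highest degree of its entries. Write $M(\lambda)=M_0+M_1\lambda+\cdots+M_d\lambda^d$ with $M_j\in\mathbb{C}^{m\times(m+n)}$. A *minimal basis* of a subspace $\mathcal V\subseteq\mathbb{C}(\lambda)^{N}$ is a basis of $\mathcal V$ consisting of polynomial vectors whose sum of degrees is minimal among all bases of $\mathcal V$ consisting of polynomial vectors. The matrix $M(\lambda)$ is called a minimal basis if its rows form a minimal basis of the subspace of $\mathbb{C}(\lambda)^{m+n}$ that they span. The *right minimal indices* of $M(\lambda)$ are the degrees of the vectors in any minimal basis of $\{x\in\mathbb{C}(\lambda)^{m+n}: M(\lambda)x=0\}$. The *leading row-wise coefficient matrix* $M_{\underline{d}}\in\mathbb{C}^{m\times(m+n)}$ is the matrix whose $i$th row is the coefficient of $\lambda^{d_i}$ in the $i$th row of $M(\lambda)$. The $k$th Sylvester matrix $S_k\in\mathbb{C}^{(k+d)m\times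 k(m+n)}$ of $M(\lambda)$ has $k+d$ block rows and $k$ block columns, and its block in position $(a,b)$ is $M_{a-b}$ if $0\le a-b\le d$ and $0$ otherwise. The $k$th *trimmed Sylvester matrix* $T_k\in\mathbb{C}^{(km+\sum_{i=1}^m d_i)\times k(m+n)}$ is obtained from $S_k$ by removing, for each $i=1,\dots,m$, the $i$th row of each of the last $d-d_i$ block rows of $S_k$ (these rows are zero). Let $\sigma_j(A)$ denote the $j$th largest singular value of a complex matrix $A$. Suppose that $M(\lambda)$ is a minimal basis and that $\operatorname{rank}(M_{\underline{d}})=m$. Let $d'$ be the largest right minimal index of $M(\lambda)$. Then \[ \sigma_{(d'm+\sum_{i=1}^m d_i)}(T_{d'})\le\inf_{\lambda_0\in\mathbb{C}}\sigma_m(M(\lambda_0)) \quad\text{and}\quad \sigma_{(d'm+\sum_{i=1}^m d_i)}(T_{d'})\le\sigma_m(M_{\underline{d}}). \] -/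

import Mathlib

open Polynomial

noncomputable section

namespace PolyMat

variable {F : Type*} [Field F]

/-- The degree of a polynomial vector: the highest degree of its entries. -/
def vecDegree {k : ℕ} (v : Fin k → F[X]) : ℕ :=
  Finset.univ.sup fun j => (v j).natDegree

/-- A polynomial vector regarded as a vector of rational functions. -/
def toRat {k : ℕ} (v : Fin k → F[X]) : Fin k → RatFunc F :=
  fun j => algebraMap F[X] (RatFunc F) (v j)

/-- `B` is a basis, consisting of polynomial vectors, of the rational subspace `V`. -/
structure IsPolyBasis {r k : ℕ} (V : Submodule (RatFunc F) (Fin k → RatFunc F))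
    (B : Fin r → Fin k → F[X]) : Prop where
  linearIndependent : LinearIndependent (RatFunc F) (fun i => toRat (B i))
  span_eq : Submodule.span (RatFunc F) (Set.range fun i => toRat (B i)) = V

/-- `B` is a minimal basis of the rational subspace `V`: a polynomial basis of `V` whose sum of
degrees is minimal among all polynomial bases of `V`. -/
structure IsMinimalBasisOf {r k : ℕ} (V : Submodule (RatFunc F) (Fin k → RatFunc F))
    (B : Fin r → Fin k → F[X]) : Prop where
  isPolyBasis : IsPolyBasis V B
  minimal : ∀ B' : Fin r → Fin k → F[X], IsPolyBasis V B' →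
    ∑ i, vecDegree (B i) ≤ ∑ i, vecDegree (B' i)

/-- The polynomial matrix `M` is a minimal basis: its rows form a minimal basis of the rational
subspace that they span. -/
def IsMinimalBasis {m k : ℕ} (M : Matrix (Fin m) (Fin k) F[X]) : Prop :=
  IsMinimalBasisOf (Submodule.span (RatFunc F) (Set.range fun i => toRat (M i))) (fun i => M i)

/-- The right null space of `M` over the field of rational functions. -/
def rightNullSpace {m k : ℕ} (M : Matrix (Fin m) (Fin k) F[X]) :
    Submodule (RatFunc F) (Fin k → RatFunc F) :=
  LinearMap.ker (M.map (algebraMap F[X] (RatFunc F))).mulVecLin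

/-- The set of right minimal indices of `M`: the degrees of the vectors in the minimal bases of
the right null space of `M`. -/
def rightMinimalIndices {m k : ℕ} (M : Matrix (Fin m) (Fin k) F[X]) : Set ℕ :=
  {ε | ∃ (r : ℕ) (B : Fin r → Fin k → F[X]) (i : Fin r),
    IsMinimalBasisOf (rightNullSpace M) B ∧ vecDegree (B i) = ε}

/-- The polynomial matrices whose `i`th row has degree at most `d i`. -/
def rowDegreeLE {m k : ℕ} (d : Fin m → ℕ) : Set (Matrix (Fin m) (Fin k) F[X]) :=
  {M | ∀ i j, (M i j).natDegree ≤ d i}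

/-- The leading row-wise coefficient matrix: its `i`th row is the coefficient of `λ ^ (d i)` in the
`i`th row of `M`. -/
def leadingRowCoeff {m k : ℕ} (d : Fin m → ℕ) (M : Matrix (Fin m) (Fin k) F[X]) :
    Matrix (Fin m) (Fin k) F :=
  Matrix.of fun i j => (M i j).coeff (d i)

/-- The value `M(z)` of a polynomial matrix at a scalar. -/
def evalAt {m k : ℕ} (M : Matrix (Fin m) (Fin k) F[X]) (z : F) : Matrix (Fin m) (Fin k) F :=
  M.map (eval z)

/-- The `s`th Sylvester matrix of a polynomial matrix `M = M₀ + M₁ λ + ⋯ + M_D λ ^ D`: it has `s + D`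
block rows and `s` block columns, and its block in position `(a, b)` (counted from zero) is
`M_{a-b}` if `0 ≤ a - b ≤ D`, and zero otherwise. -/
def sylvester {m k : ℕ} (D : ℕ) (M : Matrix (Fin m) (Fin k) F[X]) (s : ℕ) :
    Matrix (Fin (s + D) × Fin m) (Fin s × Fin k) F :=
  Matrix.of fun a b =>
    if b.1.val ≤ a.1.val ∧ a.1.val - b.1.val ≤ D then
      (M a.2 b.2).coeff (a.1.val - b.1.val)
    else 0

/-- The rows of the `s`th Sylvester matrix, with `D = max d`, that are kept in the trimmed one:
for each `i`, the last `D - d i` of the rows that come from the `i`th row of `M` are removed. -/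
abbrev TrimmedRow {m : ℕ} (d : Fin m → ℕ) (s : ℕ) : Type :=
  {a : Fin (s + Finset.univ.sup d) × Fin m // a.1.val < s + d a.2}

/-- The `s`th trimmed Sylvester matrix of `M`, for the list `d` of bounds on the row degrees. -/
def trimmedSylvester {m k : ℕ} (d : Fin m → ℕ) (M : Matrix (Fin m) (Fin k) F[X]) (s : ℕ) :
    Matrix (TrimmedRow d s) (Fin s × Fin k) F :=
  (sylvester (Finset.univ.sup d) M s).submatrix Subtype.val id

/-- The `j`th largest singular value `σ_j(A)`, for `1 ≤ j`, of a complex matrix, with multiplicity.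
Mathlib counts singular values from zero. -/
def sigma {p q : Type*} [Fintype p] [Fintype q] [DecidableEq q] (j : ℕ) (A : Matrix p q ℂ) : ℝ :=
  A.toEuclideanLin.singularValues (j - 1)

end PolyMat

end

/-! For a matrix with p rows, σ_p(A) is the minimum of ‖yA‖/‖y‖ over nonzero row vectors y, so it
suffices to turn a minimizing u for M(z) or for the leading matrix into a good test vector y for T_k
(`sigma_card_le_sigma_card`). For M(z), take y with entries z^a u_i: block b of yT_k is z^b uM(z),
so ‖yT_k‖² = K‖uM(z)‖² and ‖y‖² ≥ K‖u‖², with K = ∑_{a<k} |z|^{2a}. For the leading matrix, put u_i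
at the last kept row for each i: only the last block of yT_k survives, and K = 1. -/

namespace LinearMap

/-! ### Variational description of the smallest singular value. -/

open Module InnerProductSpace

variable {𝕜 : Type*} [RCLike 𝕜]
  {E : Type*} [NormedAddCommGroup E] [InnerProductSpace 𝕜 E] [FiniteDimensional 𝕜 E]
  {F : Type*} [NormedAddCommGroup F] [InnerProductSpace 𝕜 F] [FiniteDimensional 𝕜 F]

/-- On the range of the adjoint, `T` expands norms by at least any number which bounds all nonzero
singular values from below. -/
theorem mul_norm_adjoint_apply_le (T : E →ₗ[𝕜] F) {s : ℝ} (hs : 0 ≤ s)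
    (h : ∀ i, T.singularValues i ≠ 0 → s ≤ T.singularValues i) (w : F) :
    s * ‖adjoint T w‖ ≤ ‖T (adjoint T w)‖ := by
  set v := adjoint T w with hv
  have hT := T.isSymmetric_adjoint_comp_self
  let b := hT.eigenvectorBasis rfl
  have hb (i) : (adjoint T ∘ₗ T) (b i) = ((T.singularValues i ^ 2 : ℝ) : 𝕜) • b i := by
    rw [T.sq_singularValues_fin rfl]
    exact hT.apply_eigenvectorBasis rfl i
  have key : ‖T v‖ ^ 2 =
      ∑ i : Fin (finrank 𝕜 E), T.singularValues i ^ 2 * ‖inner 𝕜 (b i) v‖ ^ 2 := by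
    have h1 : ((‖T v‖ ^ 2 : ℝ) : 𝕜) = inner 𝕜 v ((adjoint T ∘ₗ T) v) := by
      rw [comp_apply, adjoint_inner_right, inner_self_eq_norm_sq_to_K]
      norm_cast
    have h2 : inner 𝕜 v ((adjoint T ∘ₗ T) v) =
        ((∑ i : Fin (finrank 𝕜 E), T.singularValues i ^ 2 * ‖inner 𝕜 (b i) v‖ ^ 2 : ℝ) :
          𝕜) := by
      rw [← b.sum_inner_mul_inner]
      rw [RCLike.ofReal_sum]
      refine Finset.sum_congr rfl fun i _ => ?_
      rw [← hT (b i) v, hb, inner_smul_left, RCLike.conj_ofReal, mul_left_comm,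
        ← inner_conj_symm v (b i), RCLike.conj_mul]
      push_cast
      rfl
    exact_mod_cast h1.trans h2
  have hle : (s * ‖v‖) ^ 2 ≤ ‖T v‖ ^ 2 := by
    rw [key, mul_pow, ← b.sum_sq_norm_inner_right v, Finset.mul_sum]
    refine Finset.sum_le_sum fun i _ => ?_
    -- Such a `b i` lies in ker T, hence is orthogonal to `v`, which is in the range of the adjoint.
    by_cases hi : T.singularValues i = 0
    · have hTb : T (b i) = 0 := by
        have h0 := hb i
        rw [hi] at h0
        have : inner 𝕜 (b i) ((adjoint T ∘ₗ T) (b i)) = 0 := by simp [h0]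
        rwa [comp_apply, adjoint_inner_right, inner_self_eq_zero] at this
      simp [hv, adjoint_inner_right, hTb]
    · have := h i hi
      gcongr
  exact le_of_sq_le_sq hle (norm_nonneg _)

/-- The singular value indexed by the dimension of the codomain bounds the adjoint from below. -/
theorem singularValues_mul_norm_le_norm_adjoint (T : E →ₗ[𝕜] F) (x : F) :
    T.singularValues (finrank 𝕜 F - 1) * ‖x‖ ≤ ‖adjoint T x‖ := by
  set s := T.singularValues (finrank 𝕜 F - 1) with hs
  rcases (T.singularValues_nonneg (finrank 𝕜 F - 1)).eq_or_lt with h0 | h0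
  · simp [hs, ← h0]
  have hrank := T.singularValues_pos_iff_lt_finrank_range.1 h0
  have hsurj : range T = ⊤ :=
    Submodule.eq_top_of_finrank_eq (le_antisymm (Submodule.finrank_le _) (by omega))
  -- A positive value at this index makes T surjective, so x = T T* w and ‖x‖² = ⟨T* w, T* x⟩;
  -- Cauchy–Schwarz finishes.
  have hx : x ∈ range (T ∘ₗ adjoint T) := by
    rw [T.range_self_comp_adjoint, hsurj]
    trivial
  obtain ⟨w, rfl⟩ := hx
  set x := (T ∘ₗ adjoint T) w with hx
  have hle : s * ‖adjoint T w‖ ≤ ‖x‖ := by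
    refine T.mul_norm_adjoint_apply_le h0.le (fun i hi => ?_) w
    have hi := T.singularValues_pos_iff_lt_finrank_range.1
      ((T.singularValues_pos_iff_ne_zero i).2 hi)
    have := Submodule.finrank_le (range T)
    exact T.singularValues_antitone (by omega)
  have hxx : ‖x‖ ^ 2 ≤ ‖adjoint T w‖ * ‖adjoint T x‖ := by
    have : ((‖x‖ ^ 2 : ℝ) : 𝕜) = inner 𝕜 (adjoint T w) (adjoint T x) := by
      rw [adjoint_inner_right, ← comp_apply, inner_self_eq_norm_sq_to_K]
      norm_cast
    calc ‖x‖ ^ 2 = ‖((‖x‖ ^ 2 : ℝ) : 𝕜)‖ := by simp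
      _ ≤ _ := by rw [this]; exact norm_inner_le_norm _ _
  rcases (norm_nonneg x).eq_or_lt with hx0 | hx0
  · simp [← hx0]
  refine le_of_mul_le_mul_left ?_ hx0
  calc ‖x‖ * (s * ‖x‖) = s * ‖x‖ ^ 2 := by ring
    _ ≤ s * (‖adjoint T w‖ * ‖adjoint T x‖) := by gcongr
    _ = (s * ‖adjoint T w‖) * ‖adjoint T x‖ := by ring
    _ ≤ ‖x‖ * ‖adjoint T x‖ := by gcongr

/-- The lower bound for the adjoint is attained. -/
theorem exists_norm_adjoint_le_singularValues_mul_norm [Nontrivial F] (T : E →ₗ[𝕜] F) :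
    ∃ u : F, u ≠ 0 ∧ ‖adjoint T u‖ ≤ T.singularValues (finrank 𝕜 F - 1) * ‖u‖ := by
  have hF : 0 < finrank 𝕜 F := finrank_pos
  set s := T.singularValues (finrank 𝕜 F - 1) with hs
  -- If s = 0, T is not surjective and T* kills a nonzero vector. Otherwise the witness is T v, with
  -- v an eigenvector of T* T for s².
  rcases (T.singularValues_nonneg (finrank 𝕜 F - 1)).eq_or_lt with h0 | h0
  · have hlt : finrank 𝕜 (range T) ≤ finrank 𝕜 F - 1 :=
      T.singularValues_eq_zero_iff_le_finrank_range.1 h0.symm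
    have hne : (range T)ᗮ ≠ ⊥ := by
      rw [Ne, Submodule.orthogonal_eq_bot_iff]
      intro h
      rw [h, finrank_top] at hlt
      omega
    obtain ⟨u, hu, hu0⟩ := Submodule.exists_mem_ne_zero_of_ne_bot hne
    rw [T.orthogonal_range, mem_ker] at hu
    exact ⟨u, hu0, by rw [hu, norm_zero, hs, ← h0, zero_mul]⟩
  · have hE : finrank 𝕜 F - 1 < finrank 𝕜 E :=
      (T.singularValues_pos_iff_lt_finrank_range.1 h0).trans_le (finrank_range_le T)
    obtain ⟨v, hv⟩ := (T.hasEigenvalue_adjoint_comp_self_sq_singularValues hE).exists_hasEigenvector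
    have hv1 : adjoint T (T v) = ((s : 𝕜) ^ 2) • v := hv.apply_eq_smul
    have hv0 := hv.2
    have hsq : ‖T v‖ ^ 2 = (s * ‖v‖) ^ 2 := by
      have : ((‖T v‖ ^ 2 : ℝ) : 𝕜) = (((s * ‖v‖) ^ 2 : ℝ) : 𝕜) := by
        push_cast
        rw [← inner_self_eq_norm_sq_to_K (𝕜 := 𝕜), ← adjoint_inner_right, hv1, inner_smul_right,
          inner_self_eq_norm_sq_to_K]
        ring
      exact_mod_cast this
    have hnorm : ‖T v‖ = s * ‖v‖ := by
      rwa [sq_eq_sq₀ (norm_nonneg _) (by positivity)] at hsq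
    refine ⟨T v, ?_, ?_⟩
    · rw [← norm_pos_iff, hnorm]
      exact mul_pos h0 (norm_pos_iff.2 hv0)
    · rw [hv1, norm_smul, hnorm, norm_pow, RCLike.norm_ofReal, sq_abs]
      exact le_of_eq (by ring)

end LinearMap

namespace PolyMat

open Matrix

theorem sigma_nonneg {p q : Type*} [Fintype p] [Fintype q] [DecidableEq q] (j : ℕ)
    (A : Matrix p q ℂ) : 0 ≤ sigma j A :=
  LinearMap.singularValues_nonneg _ _

section Sigma

variable {p q : Type*} [Fintype p] [Fintype q] [DecidableEq p] [DecidableEq q]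

/-- Conjugating entrywise trades the adjoint for row vectors, so no conjugates appear later. -/
theorem norm_sq_adjoint_toEuclideanLin (A : Matrix p q ℂ) (x : EuclideanSpace ℂ p) :
    ‖A.toEuclideanLin.adjoint x‖ ^ 2 = ∑ j, ‖((star x.ofLp) ᵥ* A) j‖ ^ 2 := by
  rw [← Matrix.toEuclideanLin_conjTranspose_eq_adjoint, EuclideanSpace.norm_sq_eq]
  refine Finset.sum_congr rfl fun j _ => ?_
  rw [← norm_star (((star x.ofLp) ᵥ* A) j), ← Pi.star_apply, Matrix.star_vecMul, star_star]
  rfl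

theorem sigma_sq_mul_sum_le (A : Matrix p q ℂ) (y : p → ℂ) :
    sigma (Fintype.card p) A ^ 2 * ∑ i, ‖y i‖ ^ 2 ≤ ∑ j, ‖(y ᵥ* A) j‖ ^ 2 := by
  have h := A.toEuclideanLin.singularValues_mul_norm_le_norm_adjoint (WithLp.toLp 2 (star y))
  have h2 := pow_le_pow_left₀ (mul_nonneg (LinearMap.singularValues_nonneg _ _) (norm_nonneg _)) h 2
  rw [norm_sq_adjoint_toEuclideanLin, mul_pow, EuclideanSpace.norm_sq_eq, finrank_euclideanSpace]
    at h2
  simpa [sigma] using h2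

theorem exists_sum_le_sigma_sq_mul [Nonempty p] (A : Matrix p q ℂ) :
    ∃ u : p → ℂ, 0 < ∑ i, ‖u i‖ ^ 2 ∧
      ∑ j, ‖(u ᵥ* A) j‖ ^ 2 ≤ sigma (Fintype.card p) A ^ 2 * ∑ i, ‖u i‖ ^ 2 := by
  obtain ⟨u, hu0, hu⟩ := A.toEuclideanLin.exists_norm_adjoint_le_singularValues_mul_norm
  have h2 := pow_le_pow_left₀ (norm_nonneg _) hu 2
  have hsum : ∑ i, ‖star u.ofLp i‖ ^ 2 = ‖u‖ ^ 2 := by simp [EuclideanSpace.norm_sq_eq]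
  rw [norm_sq_adjoint_toEuclideanLin, mul_pow, finrank_euclideanSpace] at h2
  refine ⟨star u.ofLp, ?_, ?_⟩
  · rw [hsum]
    have := norm_pos_iff.2 hu0
    positivity
  · rwa [hsum]

/-- Comparison of smallest singular values: it suffices to map row vectors to row vectors. -/
theorem sigma_card_le_sigma_card {p' q' : Type*} [Fintype p'] [Fintype q'] [DecidableEq p']
    [DecidableEq q'] [Nonempty p'] (A : Matrix p q ℂ) (B : Matrix p' q' ℂ) {K : ℝ} (hK : 0 < K)
    (h : ∀ u : p' → ℂ, ∃ y : p → ℂ, K * ∑ i, ‖u i‖ ^ 2 ≤ ∑ i, ‖y i‖ ^ 2 ∧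
      ∑ j, ‖(y ᵥ* A) j‖ ^ 2 ≤ K * ∑ j, ‖(u ᵥ* B) j‖ ^ 2) :
    sigma (Fintype.card p) A ≤ sigma (Fintype.card p') B := by
  obtain ⟨u, hu0, hu⟩ := exists_sum_le_sigma_sq_mul B
  obtain ⟨y, hy, hyA⟩ := h u
  have h1 := sigma_sq_mul_sum_le A y
  refine le_of_sq_le_sq ?_ (sigma_nonneg _ _)
  refine le_of_mul_le_mul_right ?_ (mul_pos hK hu0)
  calc sigma (Fintype.card p) A ^ 2 * (K * ∑ i, ‖u i‖ ^ 2)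
      ≤ sigma (Fintype.card p) A ^ 2 * ∑ i, ‖y i‖ ^ 2 := by gcongr
    _ ≤ K * ∑ j, ‖(u ᵥ* B) j‖ ^ 2 := h1.trans hyA
    _ ≤ K * (sigma (Fintype.card p') B ^ 2 * ∑ i, ‖u i‖ ^ 2) := by gcongr
    _ = _ := by ring

end Sigma

/-! ### Row vectors times the trimmed Sylvester matrix. -/

section Trimmed

variable {m k : ℕ} (d : Fin m → ℕ) (s : ℕ)

/-- The rows of the trimmed Sylvester matrix, sorted by the row of the polynomial matrix. -/
def trimmedRowEquiv : TrimmedRow d s ≃ Σ i : Fin m, Fin (s + d i) where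
  toFun a := ⟨a.1.2, a.1.1, a.2⟩
  invFun a := ⟨(⟨a.2, by
    have := Finset.le_sup (f := d) (Finset.mem_univ a.1)
    omega⟩, a.1), a.2.2⟩
  left_inv _ := rfl
  right_inv _ := rfl

theorem card_trimmedRow : Fintype.card (TrimmedRow d s) = s * m + ∑ i, d i := by
  rw [Fintype.card_congr (trimmedRowEquiv d s)]
  simp [Finset.sum_add_distrib, mul_comm]

theorem sum_trimmedRow {R : Type*} [AddCommMonoid R] (f : ℕ → Fin m → R) :
    ∑ a : TrimmedRow d s, f a.1.1 a.1.2 = ∑ i, ∑ a ∈ Finset.range (s + d i), f a i := by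
  rw [← (trimmedRowEquiv d s).symm.sum_comp, Fintype.sum_sigma]
  exact Finset.sum_congr rfl fun i _ => Fin.sum_univ_eq_sum_range (fun a => f a i) _

variable {d s} {F : Type*} [Field F]

/-- Block column b lists the coefficients of λ^b M; the degree bounds make the cut-off at max d
harmless. -/
theorem trimmedSylvester_apply {M : Matrix (Fin m) (Fin k) F[X]} (hM : M ∈ rowDegreeLE d)
    (a : TrimmedRow d s) (b : Fin s × Fin k) :
    trimmedSylvester d M s a b = (X ^ (b.1 : ℕ) * M a.1.2 b.2).coeff a.1.1 := by
  rw [coeff_X_pow_mul']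
  by_cases h : (b.1 : ℕ) ≤ a.1.1
  · by_cases h' : (a.1.1 : ℕ) - b.1 ≤ Finset.univ.sup d
    · rw [if_pos h]
      exact if_pos ⟨h, h'⟩
    · have h1 := Finset.le_sup (f := d) (Finset.mem_univ a.1.2)
      have h2 := hM a.1.2 b.2
      have h3 : (M a.1.2 b.2).coeff (a.1.1 - b.1) = 0 := coeff_eq_zero_of_natDegree_lt (by omega)
      simp [trimmedSylvester, sylvester, h3]
  · simp [trimmedSylvester, sylvester, h]

theorem vecMul_trimmedSylvester {M : Matrix (Fin m) (Fin k) F[X]} (hM : M ∈ rowDegreeLE d)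
    (y : ℕ → Fin m → F) (b : Fin s × Fin k) :
    ((fun a : TrimmedRow d s => y a.1.1 a.1.2) ᵥ* trimmedSylvester d M s) b =
      ∑ i, ∑ a ∈ Finset.range (s + d i), y a i * (X ^ (b.1 : ℕ) * M i b.2).coeff a := by
  simp only [Matrix.vecMul, dotProduct, trimmedSylvester_apply hM]
  exact sum_trimmedRow d s fun a i => y a i * (X ^ (b.1 : ℕ) * M i b.2).coeff a

theorem vecMul_trimmedSylvester_pow {M : Matrix (Fin m) (Fin k) F[X]} (hM : M ∈ rowDegreeLE d)
    (z : F) (u : Fin m → F) (b : Fin s × Fin k) :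
    ((fun a : TrimmedRow d s => z ^ (a.1.1 : ℕ) * u a.1.2) ᵥ* trimmedSylvester d M s) b =
      z ^ (b.1 : ℕ) * (u ᵥ* evalAt M z) b.2 := by
  rw [vecMul_trimmedSylvester hM fun a i => z ^ a * u i]
  simp only [Matrix.vecMul, dotProduct, Finset.mul_sum]
  refine Finset.sum_congr rfl fun i _ => ?_
  -- No coefficient is lost to trimming, so the sum is a full evaluation at z.
  have hdeg : (X ^ (b.1 : ℕ) * M i b.2).natDegree < s + d i := by
    have h1 := natDegree_mul_le (p := X ^ (b.1 : ℕ)) (q := M i b.2)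
    rw [natDegree_X_pow] at h1
    have := hM i b.2
    have := b.1.2
    omega
  have he := eval_eq_sum_range' hdeg z
  rw [eval_mul, eval_pow, eval_X] at he
  rw [evalAt, Matrix.map_apply, mul_left_comm, he, Finset.mul_sum]
  exact Finset.sum_congr rfl fun a _ => by ring

theorem vecMul_trimmedSylvester_single {M : Matrix (Fin m) (Fin k) F[X]} (hM : M ∈ rowDegreeLE d)
    (u : Fin m → F) (b : Fin s × Fin k) :
    ((fun a : TrimmedRow d s => if (a.1.1 : ℕ) + 1 = s + d a.1.2 then u a.1.2 else 0) ᵥ*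
      trimmedSylvester d M s) b =
      if (b.1 : ℕ) + 1 = s then (u ᵥ* leadingRowCoeff d M) b.2 else 0 := by
  rw [vecMul_trimmedSylvester hM fun a i => if a + 1 = s + d i then u i else 0]
  have hb := b.1.2
  have hi (i : Fin m) : ∑ a ∈ Finset.range (s + d i),
      (if a + 1 = s + d i then u i else 0) * (X ^ (b.1 : ℕ) * M i b.2).coeff a =
      if (b.1 : ℕ) + 1 = s then u i * leadingRowCoeff d M i b.2 else 0 := by
    rw [Finset.sum_eq_single (s + d i - 1)]
    · rw [if_pos (by omega), coeff_X_pow_mul', if_pos (by omega)]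
      split_ifs with h
      · rw [show s + d i - 1 - b.1 = d i by omega]
        rfl
      -- For b < s - 1 the index s + d i - 1 - b exceeds the degree bound d i.
      · have := hM i b.2
        rw [coeff_eq_zero_of_natDegree_lt (by omega), mul_zero]
    · intro a _ ha
      rw [if_neg (by omega), zero_mul]
    · intro h
      rw [Finset.mem_range] at h
      omega
  simp only [hi]
  split_ifs <;> simp [Matrix.vecMul, dotProduct]

end Trimmed

/-! ### The two bounds, by explicit test vectors. -/

section Bounds

variable {m k : ℕ} {d : Fin m → ℕ} {M : Matrix (Fin m) (Fin k) ℂ[X]}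

theorem sigma_trimmedSylvester_zero (j : ℕ) : sigma j (trimmedSylvester d M 0) = 0 :=
  LinearMap.singularValues_of_finrank_le _ (by simp)

theorem sigma_trimmedSylvester_le_sigma_evalAt (hm : 0 < m) (hM : M ∈ rowDegreeLE d) (s : ℕ)
    (z : ℂ) :
    sigma (s * m + ∑ i, d i) (trimmedSylvester d M s) ≤ sigma m (evalAt M z) := by
  have : Nonempty (Fin m) := ⟨⟨0, hm⟩⟩
  -- For s = 0 there are no columns, and K would be an empty sum.
  rcases s with _ | s
  · rw [sigma_trimmedSylvester_zero]
    exact sigma_nonneg _ _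
  rw [← card_trimmedRow]
  refine (sigma_card_le_sigma_card _ (evalAt M z)
    (K := ∑ a ∈ Finset.range (s + 1), ‖z ^ a‖ ^ 2) ?_ fun u => ?_).trans_eq
    (by rw [Fintype.card_fin])
  · rw [Finset.sum_range_succ']
    simp only [pow_zero, norm_one, one_pow]
    positivity
  refine ⟨fun a => z ^ (a.1.1 : ℕ) * u a.1.2, ?_, le_of_eq ?_⟩
  · rw [sum_trimmedRow d (s + 1) fun a i => ‖z ^ a * u i‖ ^ 2, Finset.mul_sum]
    refine Finset.sum_le_sum fun i _ => ?_
    simp only [norm_mul, mul_pow]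
    rw [← Finset.sum_mul]
    refine mul_le_mul_of_nonneg_right ?_ (by positivity)
    -- Row i of M contributes s + 1 + d i powers of z, of which K uses only the first s + 1, one per
    -- block column.
    exact Finset.sum_le_sum_of_subset_of_nonneg (Finset.range_mono (Nat.le_add_right _ _))
      fun _ _ _ => by positivity
  · simp only [vecMul_trimmedSylvester_pow hM, norm_mul, mul_pow]
    rw [Fintype.sum_prod_type, ← Fin.sum_univ_eq_sum_range (fun a => ‖z ^ a‖ ^ 2),
      Finset.sum_mul_sum]

theorem sigma_trimmedSylvester_le_sigma_leadingRowCoeff (hm : 0 < m) (hM : M ∈ rowDegreeLE d)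
    (s : ℕ) :
    sigma (s * m + ∑ i, d i) (trimmedSylvester d M s) ≤ sigma m (leadingRowCoeff d M) := by
  have : Nonempty (Fin m) := ⟨⟨0, hm⟩⟩
  rcases s with _ | s
  · rw [sigma_trimmedSylvester_zero]
    exact sigma_nonneg _ _
  rw [← card_trimmedRow]
  refine (sigma_card_le_sigma_card _ (leadingRowCoeff d M) one_pos fun u => ?_).trans_eq
    (by rw [Fintype.card_fin])
  refine ⟨fun a => if (a.1.1 : ℕ) + 1 = s + 1 + d a.1.2 then u a.1.2 else 0, ?_, ?_⟩
  · rw [sum_trimmedRow d (s + 1) fun a i => ‖if a + 1 = s + 1 + d i then u i else 0‖ ^ 2, one_mul]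
    refine Finset.sum_le_sum fun i _ => ?_
    refine le_trans (le_of_eq ?_) (Finset.single_le_sum (fun a _ => by positivity)
      (Finset.mem_range.2 (show s + d i < s + 1 + d i by omega)))
    rw [if_pos (by omega)]
  · simp only [vecMul_trimmedSylvester_single hM]
    rw [Fintype.sum_prod_type, one_mul, Fintype.sum_eq_single (Fin.last s)]
    · simp
    · intro b hb
      have : (b : ℕ) ≠ s := fun h => hb (Fin.ext h)
      simp [this]

end Bounds

end PolyMat

theorem mainTheorem8 (m n : ℕ) (hm : 0 < m) (hn : 0 < n)
    (d : Fin m → ℕ) (hd : 0 < Finset.univ.sup d)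
    (M : Matrix (Fin m) (Fin (m + n)) (Polynomial ℂ))
    (hMd : M ∈ PolyMat.rowDegreeLE d)
    (hM : PolyMat.IsMinimalBasis M)
    (hrank : (PolyMat.leadingRowCoeff d M).rank = m)
    (d' : ℕ) (hd' : IsGreatest (PolyMat.rightMinimalIndices M) d') :
    PolyMat.sigma (d' * m + ∑ i, d i) (PolyMat.trimmedSylvester d M d') ≤
        (⨅ z : ℂ, PolyMat.sigma m (PolyMat.evalAt M z)) ∧
      PolyMat.sigma (d' * m + ∑ i, d i) (PolyMat.trimmedSylvester d M d') ≤
        PolyMat.sigma m (PolyMat.leadingRowCoeff d M) := by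
  exact ⟨le_ciInf fun z => PolyMat.sigma_trimmedSylvester_le_sigma_evalAt hm hMd d' z,
    PolyMat.sigma_trimmedSylvester_le_sigma_leadingRowCoeff hm hMd d'⟩
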